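/- **Theorem 3.** Let $A\in\mathbb R^{n\times n}$, $B_1\in\mathbb R^{n\times k}$, $B_2\in\mathbb R^{n\times n_u}$, $C_1\in\mathbb R^{p\times n}$, $D_{12}\in\mathbb R^{q\times n_u}$ with $D_{12}^TD_{12}\succ0$, and let $P_u\in\mathbb R^{r\times n_u}$ have linearly independent rows. Put $R_1=P_uD_{12}^TD_{12}P_u^T$ and $M=B_2P_u^TR_1^{-1}P_uB_2^T$. Let $X=X^T\in\mathbb R^{n\times n}$ be the stabilizing solution of the algebraic Riccati equation $$A^TX+XA+C_1^TC_1-XMX=0,$$ i.e. all eigenvalues of $A-MX$ have negative real part. Let $$H=\begin{bmatrix}A&-M\\-C_1^TC_1&-A^T\end{bmatrix},\qquad H\begin{bmatrix}Z_1\\Z_2\end{bmatrix}=\begin{bmatrix}Z_1\\Z_2\end{bmatrix}\Lambda^-,\qquad \Lambda^-=\mathrm{diag}(\lambda_1^-,\dots,\lambda_n^-),$$ where $Z_1,Z_2\in\mathbb C^{n\times n}$, $\operatorname{Re}\lambda_i^-<0$ for all $i$, and the columns of $\begin{bmatrix}Z_1\\Z_2\end{bmatrix}$ span the stable invariant subspace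 of $H$ (the sum of its generalized eigenspaces for the eigenvalues in the open left half-plane). Let $S\subseteq\{1,\dots,n\}$ (for instance $S=\{1,\dots,\kappa\}$), let $Z_{1\kappa},Z_{2\kappa}$ consist of the columns of $Z_1,Z_2$ with index in $S$ and $Z_{1\bar\kappa},Z_{2\bar\kappa}$ of the remaining columns, and assume that $Z_{2\kappa}^*Z_{1\kappa}$ is invertible, where ${}^*$ is the conjugate transpose (the transpose ${}^T$ for real matrices). Define $$\bar X=Z_{2\kappa}(Z_{2\kappa}^*Z_{1\kappa})^{-1}Z_{2\kappa}^*,\qquad E_\kappa=Z_{2\bar\kappa}-Z_{2\kappa}(Z_{2\kappa}^*Z_{1\kappa})^{-1}Z_{2\kappa}^*Z_{1\bar\kappa},\qquad W_x(s)=(sI-A+MX)^{-1}B_1 .$$ Then $Z_1$ is invertible and $X=Z_2Z_1^{-1}$; the Cauchy-like matrix $$\mathcal C_{ij}=-\frac{1}{\lambda_i^-+\overline{\lambda_j^-}}\,\bigl[Z_1^{-1}B_1B_1^TZ_1^{-*}\bigr]_{ij}$$ has real nonnegative diagonal entries; the function $\omega\mapsto\operatorname{tr}[g(j\omega)^*g(j\omega)]$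 with $g=(X-\bar X)W_x$ is integrable over $\mathbb R$; and $$\|(X-\bar X)W_x\|_{\mathcal H_2}\le\epsilon\,\|E_\kappa\|_F,\qquad \epsilon=\sqrt{\sum_{i\notin S}\mathcal C_{ii}},$$ where $\|g\|_{\mathcal H_2}=\bigl(\frac1{2\pi}\int_{-\infty}^{\infty}\operatorname{tr}[g(j\omega)^*g(j\omega)]\,d\omega\bigr)^{1/2}$ and $\|E\|_F=\sqrt{\operatorname{tr}(EE^*)}$. -/

import Mathlib

namespace HamiltonianApprox

open Matrix

noncomputable section

/-- Entrywise inclusion of real matrices into complex matrices. -/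
abbrev toC {m n : Type*} (A : Matrix m n ℝ) : Matrix m n ℂ := A.map Complex.ofReal

/-- A real square matrix is Hurwitz if all its complex eigenvalues lie in the open left
half-plane. -/
def IsHurwitz {n : ℕ} (A : Matrix (Fin n) (Fin n) ℝ) : Prop :=
  ∀ μ ∈ spectrum ℂ (toC A), μ.re < 0

/-- `R₁ = P_u D₁₂ᵀ D₁₂ P_uᵀ`. -/
def inputWeight {r nu q : ℕ} (Pu : Matrix (Fin r) (Fin nu) ℝ) (D₁₂ : Matrix (Fin q) (Fin nu) ℝ) :
    Matrix (Fin r) (Fin r) ℝ :=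
  Pu * D₁₂ᵀ * D₁₂ * Puᵀ

/-- `M = B₂ P_uᵀ R₁⁻¹ P_u B₂ᵀ`. -/
def quadTerm {n r nu q : ℕ} (B₂ : Matrix (Fin n) (Fin nu) ℝ) (Pu : Matrix (Fin r) (Fin nu) ℝ)
    (D₁₂ : Matrix (Fin q) (Fin nu) ℝ) : Matrix (Fin n) (Fin n) ℝ :=
  B₂ * Puᵀ * (inputWeight Pu D₁₂)⁻¹ * Pu * B₂ᵀ

/-- `X` is the (symmetric) stabilizing solution of the algebraic Riccati equation
`AᵀX + XA + C₁ᵀC₁ - XMX = 0`. -/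
structure IsStabilizingSolution {n p : ℕ} (A M : Matrix (Fin n) (Fin n) ℝ)
    (C₁ : Matrix (Fin p) (Fin n) ℝ) (X : Matrix (Fin n) (Fin n) ℝ) : Prop where
  symm : Xᵀ = X
  riccati : Aᵀ * X + X * A + C₁ᵀ * C₁ - X * M * X = 0
  hurwitz : IsHurwitz (A - M * X)

/-- The Hamiltonian matrix of the Riccati equation. -/
def hamiltonian {n p : ℕ} (A M : Matrix (Fin n) (Fin n) ℝ) (C₁ : Matrix (Fin p) (Fin n) ℝ) :
    Matrix (Fin n ⊕ Fin n) (Fin n ⊕ Fin n) ℝ :=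
  Matrix.fromBlocks A (-M) (-(C₁ᵀ * C₁)) (-Aᵀ)

/-- The stable invariant subspace of a complex matrix: the sum of its generalized eigenspaces
for the eigenvalues in the open left half-plane. -/
def stableSubspace {ι : Type*} [Fintype ι] [DecidableEq ι] (N : Matrix ι ι ℂ) :
    Submodule ℂ (ι → ℂ) :=
  ⨆ μ : {μ : ℂ // μ.re < 0}, Module.End.maxGenEigenspace (Matrix.toLin' N) (μ : ℂ)

/-- The columns of `[Z₁; Z₂]` are eigenvectors of `H` for the stable eigenvalues `lam`, and they
span the stable invariant subspace of `H`. -/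
structure IsStableEigenbasis {n : ℕ} (H : Matrix (Fin n ⊕ Fin n) (Fin n ⊕ Fin n) ℝ)
    (Z₁ Z₂ : Matrix (Fin n) (Fin n) ℂ) (lam : Fin n → ℂ) : Prop where
  stable : ∀ i, (lam i).re < 0
  eigen : toC H * Matrix.fromRows Z₁ Z₂ = Matrix.fromRows Z₁ Z₂ * Matrix.diagonal lam
  span : Submodule.span ℂ (Set.range (Matrix.fromRows Z₁ Z₂).col) = stableSubspace (toC H)

/-- The columns of `Z` with index in `S`. -/
def colsIn {n : ℕ} (Z : Matrix (Fin n) (Fin n) ℂ) (S : Finset (Fin n)) :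
    Matrix (Fin n) {i // i ∈ S} ℂ :=
  Z.submatrix id Subtype.val

/-- `Z_{2κ} (Z_{2κ}ᴴ Z_{1κ})⁻¹ Z_{2κ}ᴴ`, where `κ` denotes the columns with index in `S`. -/
def approxSolution {n : ℕ} (Z₁ Z₂ : Matrix (Fin n) (Fin n) ℂ) (S : Finset (Fin n)) :
    Matrix (Fin n) (Fin n) ℂ :=
  colsIn Z₂ S * ((colsIn Z₂ S)ᴴ * colsIn Z₁ S)⁻¹ * (colsIn Z₂ S)ᴴ

/-- `E_κ = Z_{2κ̄} - Z_{2κ} (Z_{2κ}ᴴ Z_{1κ})⁻¹ Z_{2κ}ᴴ Z_{1κ̄}`. -/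
def errorFactor {n : ℕ} (Z₁ Z₂ : Matrix (Fin n) (Fin n) ℂ) (S : Finset (Fin n)) :
    Matrix (Fin n) {i // i ∈ Sᶜ} ℂ :=
  colsIn Z₂ Sᶜ -
    colsIn Z₂ S * ((colsIn Z₂ S)ᴴ * colsIn Z₁ S)⁻¹ * (colsIn Z₂ S)ᴴ * colsIn Z₁ Sᶜ

/-- The Cauchy-like matrix `C i j = -[Z₁⁻¹ B₁ B₁ᵀ Z₁⁻ᴴ] i j / (lam i + conj (lam j))`. -/
def cauchyLike {n k : ℕ} (Z₁ : Matrix (Fin n) (Fin n) ℂ) (B₁ : Matrix (Fin n) (Fin k) ℝ)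
    (lam : Fin n → ℂ) : Matrix (Fin n) (Fin n) ℂ :=
  Matrix.of fun i j =>
    -(1 / (lam i + star (lam j))) * (Z₁⁻¹ * toC B₁ * (toC B₁)ᵀ * (Z₁⁻¹)ᴴ) i j

/-- The frequency weight `W_x(s) = (sI - A + MX)⁻¹ B₁`. -/
def freqWeight {n k : ℕ} (A M X : Matrix (Fin n) (Fin n) ℝ) (B₁ : Matrix (Fin n) (Fin k) ℝ)
    (s : ℂ) : Matrix (Fin n) (Fin k) ℂ :=
  (s • (1 : Matrix (Fin n) (Fin n) ℂ) - toC A + toC M * toC X)⁻¹ * toC B₁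

/-- The Frobenius norm `√ tr(E Eᴴ)`. -/
def frobNorm {m n : Type*} [Fintype m] [Fintype n] (E : Matrix m n ℂ) : ℝ :=
  Real.sqrt (E * Eᴴ).trace.re

/-- The integrand `tr[g(jω)ᴴ g(jω)]` of the squared `H₂` norm. -/
def h2Integrand {m n : Type*} [Fintype m] [Fintype n] (g : ℂ → Matrix m n ℂ) (ω : ℝ) : ℝ :=
  ((g (Complex.I * ω))ᴴ * g (Complex.I * ω)).trace.re

/-- The `H₂` norm `√ ((1/2π) ∫ tr[g(jω)ᴴ g(jω)] dω)`. It is meaningful when `h2Integrand g` is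
integrable. -/
def h2Norm {m n : Type*} [Fintype m] [Fintype n] (g : ℂ → Matrix m n ℂ) : ℝ :=
  Real.sqrt (1 / (2 * Real.pi) * ∫ ω : ℝ, h2Integrand g ω)

end

end HamiltonianApprox

/-! With N = A - MX, the Riccati equation gives -Nᵀ W = W Λ for W = Z₂ - X Z₁. Here -Nᵀ has its
spectrum in the right half-plane and Λ is stable, so W = 0 (`eq_mul`). The graph of X lies in the
stable subspace, so Z₁ is onto (`isUnit`). Hence Z₁ diagonalizes N. Moreover (X - X̄) Z₁ vanishes on
the columns in S and equals E_κ on the others (`sub_approxSolution_mul_mul`). The error is therefore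
E_κ (sI - Λ_κ̄)⁻¹ F, where F holds the rows of Z₁⁻¹ B₁ outside S. Submultiplicativity of the
Frobenius norm pulls E_κ out, and ∫ |jω - λ|⁻² dω = π / (-Re λ) turns the rest into the sum of the
𝒞ᵢᵢ. -/

namespace HamiltonianApprox

open Matrix MeasureTheory

section RealToComplex

variable {l m n : Type*}

theorem toC_mul [Fintype m] (A : Matrix l m ℝ) (B : Matrix m n ℝ) :
    toC (A * B) = toC A * toC B :=
  Matrix.map_mul (f := Complex.ofRealHom)

theorem toC_add (A B : Matrix m n ℝ) : toC (A + B) = toC A + toC B := by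
  ext i j; simp [toC]

theorem toC_sub (A B : Matrix m n ℝ) : toC (A - B) = toC A - toC B := by
  ext i j; simp [toC]

theorem toC_neg (A : Matrix m n ℝ) : toC (-A) = -toC A := by
  ext i j; simp [toC]

theorem toC_zero : toC (0 : Matrix m n ℝ) = 0 := by
  ext i j; simp [toC]

theorem toC_transpose (A : Matrix m n ℝ) : toC Aᵀ = (toC A)ᵀ := rfl

theorem toC_conjTranspose (A : Matrix m n ℝ) : (toC A)ᴴ = (toC A)ᵀ := by
  ext i j; simp [toC]

end RealToComplex

/-! ### Riccati solution and stable subspace of the Hamiltonian. -/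

section Riccati

variable {n p : ℕ} {A M X : Matrix (Fin n) (Fin n) ℝ} {C₁ : Matrix (Fin p) (Fin n) ℝ}
  {Z₁ Z₂ : Matrix (Fin n) (Fin n) ℂ} {lam : Fin n → ℂ}

theorem quadTerm_transpose {r nu q : ℕ} (B₂ : Matrix (Fin n) (Fin nu) ℝ)
    (Pu : Matrix (Fin r) (Fin nu) ℝ) (D₁₂ : Matrix (Fin q) (Fin nu) ℝ) :
    (quadTerm B₂ Pu D₁₂)ᵀ = quadTerm B₂ Pu D₁₂ := by
  simp [quadTerm, inputWeight, Matrix.transpose_mul, Matrix.transpose_nonsing_inv,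
    Matrix.mul_assoc]

theorem toC_hamiltonian : toC (hamiltonian A M C₁) =
    Matrix.fromBlocks (toC A) (-toC M) (-((toC C₁)ᵀ * toC C₁)) (-(toC A)ᵀ) := by
  simp only [hamiltonian, toC, Matrix.fromBlocks_map]
  congr 1
  · exact toC_neg M
  · exact (toC_neg _).trans (congrArg _ (toC_mul _ _))
  · exact toC_neg _

theorem IsStabilizingSolution.toC_riccati (hX : IsStabilizingSolution A M C₁ X) :
    (toC A)ᵀ * toC X + toC X * toC A + (toC C₁)ᵀ * toC C₁ - toC X * toC M * toC X = 0 := by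
  have h := congrArg toC hX.riccati
  simpa only [toC_sub, toC_add, toC_mul, toC_zero, toC_transpose] using h

theorem IsStableEigenbasis.eigen_top (hZ : IsStableEigenbasis (hamiltonian A M C₁) Z₁ Z₂ lam) :
    toC A * Z₁ - toC M * Z₂ = Z₁ * diagonal lam := by
  have h := hZ.eigen
  rw [toC_hamiltonian, Matrix.fromBlocks_mul_fromRows, Matrix.fromRows_mul,
    Matrix.fromRows_ext_iff] at h
  simpa [sub_eq_add_neg] using h.1

theorem IsStableEigenbasis.eigen_bottom
    (hZ : IsStableEigenbasis (hamiltonian A M C₁) Z₁ Z₂ lam) :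
    -((toC C₁)ᵀ * toC C₁ * Z₁) - (toC A)ᵀ * Z₂ = Z₂ * diagonal lam := by
  have h := hZ.eigen
  rw [toC_hamiltonian, Matrix.fromBlocks_mul_fromRows, Matrix.fromRows_mul,
    Matrix.fromRows_ext_iff] at h
  simpa [sub_eq_add_neg] using h.2

/-- A matrix `W` with `-Nᵀ W = W Λ`, where `N` is Hurwitz and `Λ` is diagonal and stable,
vanishes. -/
theorem IsHurwitz.eq_zero_of_neg_transpose_mul_eq {N : Matrix (Fin n) (Fin n) ℝ}
    (hN : IsHurwitz N) (hlam : ∀ i, (lam i).re < 0) {W : Matrix (Fin n) (Fin n) ℂ}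
    (hW : -((toC N)ᵀ * W) = W * diagonal lam) : W = 0 := by
  by_contra hne
  obtain ⟨j, hj⟩ : ∃ j, W.col j ≠ 0 := by
    by_contra! h
    exact hne (by ext i j; exact congrFun (h j) i)
  have hcol : (toC N)ᵀ *ᵥ W.col j = (-lam j) • W.col j := by
    ext i
    have h := congrFun (congrFun hW i) j
    rw [Matrix.mul_diagonal, Matrix.neg_apply, Matrix.mul_apply] at h
    simp only [Matrix.mulVec, dotProduct, Matrix.col_apply, Pi.smul_apply, smul_eq_mul]
    linear_combination -h
  have hev : Module.End.HasEigenvalue (Matrix.toLin' (toC N)ᵀ) (-lam j) :=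
    Module.End.hasEigenvalue_of_hasEigenvector
      ⟨Module.End.mem_eigenspace_iff.mpr (by simpa using hcol), hj⟩
  -- N and Nᵀ share their characteristic polynomial, and -λⱼ has positive real part.
  have hspec : -lam j ∈ spectrum ℂ (toC N) := by
    have h := hev.mem_spectrum
    rw [Matrix.spectrum_toLin'] at h
    rw [Matrix.mem_spectrum_iff_isRoot_charpoly] at h ⊢
    rwa [Matrix.charpoly_transpose] at h
  have h1 := hN _ hspec
  have h2 := hlam j
  rw [Complex.neg_re] at h1
  linarith

theorem IsStableEigenbasis.eq_mul (hM : Mᵀ = M) (hX : IsStabilizingSolution A M C₁ X)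
    (hZ : IsStableEigenbasis (hamiltonian A M C₁) Z₁ Z₂ lam) : toC X * Z₁ = Z₂ := by
  have hW : Z₂ - toC X * Z₁ = 0 := by
    refine hX.hurwitz.eq_zero_of_neg_transpose_mul_eq hZ.stable ?_
    have hN : (toC (A - M * X))ᵀ = (toC A)ᵀ - toC X * toC M := by
      rw [← toC_transpose, Matrix.transpose_sub, Matrix.transpose_mul, hX.symm, hM, toC_sub,
        toC_mul, toC_transpose]
    have hR := congrArg (· * Z₁) hX.toC_riccati
    simp only [Matrix.sub_mul, Matrix.add_mul, Matrix.zero_mul, Matrix.mul_assoc] at hR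
    have hb := hZ.eigen_bottom
    simp only [Matrix.mul_assoc] at hb
    rw [hN, Matrix.sub_mul Z₂, ← hb, Matrix.mul_assoc, ← hZ.eigen_top]
    simp only [Matrix.sub_mul, Matrix.mul_sub, Matrix.mul_assoc]
    -- The two sides differ by the Riccati residual times Z₁.
    rw [← sub_eq_zero, ← hR]
    abel
  exact (sub_eq_zero.mp hW).symm

/-- The graph of X is invariant under H; the lower block row is the Riccati equation. -/
theorem mul_fromRows_one (hX : IsStabilizingSolution A M C₁ X) :
    toC (hamiltonian A M C₁) * Matrix.fromRows (1 : Matrix (Fin n) (Fin n) ℂ) (toC X) =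
      Matrix.fromRows (1 : Matrix (Fin n) (Fin n) ℂ) (toC X) * toC (A - M * X) := by
  rw [toC_hamiltonian, Matrix.fromBlocks_mul_fromRows, Matrix.fromRows_mul]
  congr 1
  · rw [toC_sub, toC_mul, Matrix.mul_one, Matrix.one_mul, Matrix.neg_mul, ← sub_eq_add_neg]
  · have hR := hX.toC_riccati
    rw [toC_sub, toC_mul, Matrix.mul_sub, ← sub_eq_zero, ← neg_eq_zero, ← hR]
    simp only [Matrix.mul_one, Matrix.neg_mul, Matrix.mul_assoc]
    abel

/-- If `H V = V N` with `N` Hurwitz, the range of `V` is contained in the stable invariant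
subspace of `H`. -/
theorem IsHurwitz.mulVec_mem_stableSubspace {ι : Type*} [Fintype ι] [DecidableEq ι]
    {N : Matrix (Fin n) (Fin n) ℝ} (hN : IsHurwitz N) {H : Matrix ι ι ℂ}
    {V : Matrix ι (Fin n) ℂ} (hV : H * V = V * toC N) (v : Fin n → ℂ) :
    V *ᵥ v ∈ stableSubspace H := by
  suffices h : (⊤ : Submodule ℂ (Fin n → ℂ)) ≤
      (stableSubspace H).comap (Matrix.toLin' V) from h (Submodule.mem_top (x := v))
  rw [← Module.End.iSup_maxGenEigenspace_eq_top (Matrix.toLin' (toC N))]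
  refine iSup_le fun μ w hw => ?_
  by_cases hμ : Module.End.HasEigenvalue (Matrix.toLin' (toC N)) μ
  · have hre : μ.re < 0 := hN μ (by
      have h := hμ.mem_spectrum
      rwa [Matrix.spectrum_toLin'] at h)
    refine Submodule.mem_iSup_of_mem (⟨μ, hre⟩ : {μ : ℂ // μ.re < 0}) ?_
    obtain ⟨k, hk⟩ := Module.End.mem_maxGenEigenspace _ _ _ |>.mp hw
    refine Module.End.mem_maxGenEigenspace _ _ _ |>.mpr ⟨k, ?_⟩
    -- V intertwines N - μ with H - μ, hence also their powers, so it preserves generalized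
    -- eigenvectors.
    have hcomm : ∀ u, (Matrix.toLin' H - μ • 1) (Matrix.toLin' V u) =
        Matrix.toLin' V ((Matrix.toLin' (toC N) - μ • 1) u) := by
      intro u
      simp [hV, Matrix.mulVec_sub, Matrix.mulVec_smul]
    have hpow : ∀ (k : ℕ) u, ((Matrix.toLin' H - μ • 1) ^ k) (Matrix.toLin' V u) =
        Matrix.toLin' V (((Matrix.toLin' (toC N) - μ • 1) ^ k) u) := by
      intro k
      induction k with
      | zero => intro u; rfl
      | succ k ih => intro u; rw [pow_succ, pow_succ, Module.End.mul_apply, hcomm, ih]; rfl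
    rw [hpow, hk, map_zero]
  · have hbot : Module.End.maxGenEigenspace (Matrix.toLin' (toC N)) μ = ⊥ := by
      by_contra h
      exact hμ (Module.End.HasUnifEigenvalue.lt zero_lt_one h)
    have hw0 : w = 0 := by simpa [hbot] using hw
    simp [hw0]

/-- Each [v; Xv] is a combination [Z₁; Z₂] c of the spanning columns; its upper half reads v = Z₁ c.
-/
theorem IsStableEigenbasis.isUnit (hX : IsStabilizingSolution A M C₁ X)
    (hZ : IsStableEigenbasis (hamiltonian A M C₁) Z₁ Z₂ lam) : IsUnit Z₁ := by
  rw [← Matrix.mulVec_surjective_iff_isUnit]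
  intro v
  have hv := hX.hurwitz.mulVec_mem_stableSubspace (mul_fromRows_one hX) v
  rw [← hZ.span, ← Matrix.range_mulVecLin] at hv
  obtain ⟨c, hc⟩ := hv
  refine ⟨c, ?_⟩
  rw [Matrix.mulVecLin_apply, Matrix.fromRows_mulVec, Matrix.fromRows_mulVec] at hc
  ext i
  simpa using congrFun hc (Sum.inl i)

/-- Substituting Z₂ = X Z₁ in the upper eigenvector equation gives (A - MX) Z₁ = Z₁ Λ. -/
theorem IsStableEigenbasis.freqWeight_eq {k : ℕ} (hM : Mᵀ = M)
    (hX : IsStabilizingSolution A M C₁ X)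
    (hZ : IsStableEigenbasis (hamiltonian A M C₁) Z₁ Z₂ lam) (B₁ : Matrix (Fin n) (Fin k) ℝ)
    {s : ℂ} (hs : ∀ i, s - lam i ≠ 0) :
    freqWeight A M X B₁ s =
      Z₁ * (diagonal (fun i => (s - lam i)⁻¹) * (Z₁⁻¹ * toC B₁)) := by
  have hdet := (Matrix.isUnit_iff_isUnit_det _).mp (hZ.isUnit hX)
  have hcl : (s • (1 : Matrix (Fin n) (Fin n) ℂ) - toC A + toC M * toC X) * Z₁ =
      Z₁ * diagonal (fun i => s - lam i) := by
    have h : diagonal (fun i => s - lam i) = s • (1 : Matrix (Fin n) (Fin n) ℂ) - diagonal lam := by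
      rw [Matrix.smul_one_eq_diagonal, Matrix.diagonal_sub]
    rw [h, Matrix.mul_sub, ← hZ.eigen_top, ← hZ.eq_mul hM hX]
    simp only [Matrix.add_mul, Matrix.sub_mul, Matrix.mul_assoc, Matrix.smul_mul, Matrix.mul_smul,
      Matrix.one_mul, Matrix.mul_one]
    abel
  have hinv : (s • (1 : Matrix (Fin n) (Fin n) ℂ) - toC A + toC M * toC X)⁻¹ =
      Z₁ * diagonal (fun i => (s - lam i)⁻¹) * Z₁⁻¹ := by
    refine Matrix.inv_eq_right_inv ?_
    have hd : diagonal (fun i => s - lam i) * diagonal (fun i => (s - lam i)⁻¹) =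
        (1 : Matrix (Fin n) (Fin n) ℂ) := by
      rw [Matrix.diagonal_mul_diagonal, ← Matrix.diagonal_one]
      congr 1
      ext i
      exact mul_inv_cancel₀ (hs i)
    rw [← Matrix.mul_assoc, ← Matrix.mul_assoc, hcl, Matrix.mul_assoc Z₁, hd, Matrix.mul_one,
      Matrix.mul_nonsing_inv _ hdet]
  rw [freqWeight, hinv]
  simp only [Matrix.mul_assoc]

end Riccati

/-! ### Factoring the approximation error through E_κ. -/

section ErrorFactor

variable {n : ℕ} {X Z₁ Z₂ : Matrix (Fin n) (Fin n) ℂ} {S : Finset (Fin n)}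

theorem sub_approxSolution_mul_apply_of_mem (hX : X * Z₁ = Z₂)
    (hS : IsUnit ((colsIn Z₂ S)ᴴ * colsIn Z₁ S)) (i : Fin n) {j : Fin n} (hj : j ∈ S) :
    ((X - approxSolution Z₁ Z₂ S) * Z₁) i j = 0 := by
  have h : approxSolution Z₁ Z₂ S * colsIn Z₁ S = colsIn Z₂ S := by
    rw [approxSolution, Matrix.mul_assoc, Matrix.mul_assoc,
      Matrix.nonsing_inv_mul _ ((Matrix.isUnit_iff_isUnit_det _).mp hS), Matrix.mul_one]
  have h' : (approxSolution Z₁ Z₂ S * Z₁) i j = Z₂ i j := congrFun (congrFun h i) ⟨j, hj⟩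
  rw [Matrix.sub_mul, hX, Matrix.sub_apply, h', sub_self]

theorem sub_approxSolution_mul_apply_of_notMem (hX : X * Z₁ = Z₂) (i : Fin n)
    (j : {j // j ∈ Sᶜ}) :
    ((X - approxSolution Z₁ Z₂ S) * Z₁) i j = errorFactor Z₁ Z₂ S i j := by
  rw [Matrix.sub_mul, hX]
  rfl

theorem sub_approxSolution_mul_mul (hX : X * Z₁ = Z₂)
    (hS : IsUnit ((colsIn Z₂ S)ᴴ * colsIn Z₁ S)) {m : Type*} (Y : Matrix (Fin n) m ℂ) :
    (X - approxSolution Z₁ Z₂ S) * (Z₁ * Y) =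
      errorFactor Z₁ Z₂ S * Y.submatrix (Subtype.val : {i // i ∈ Sᶜ} → Fin n) id := by
  ext i j
  rw [← Matrix.mul_assoc, Matrix.mul_apply, Matrix.mul_apply, ← Finset.sum_add_sum_compl S,
    Finset.sum_eq_zero (s := S), zero_add, ← Finset.sum_coe_sort Sᶜ]
  · exact Finset.sum_congr rfl fun l _ => by
      rw [sub_approxSolution_mul_apply_of_notMem hX]; rfl
  · intro l hl
    rw [sub_approxSolution_mul_apply_of_mem hX hS i hl, zero_mul]

end ErrorFactor

/-! ### Frobenius norms as entry sums. -/

section Norms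

variable {l m n : Type*} [Fintype l] [Fintype m] [Fintype n]

theorem trace_mul_conjTranspose_re (E : Matrix m n ℂ) :
    (E * Eᴴ).trace.re = ∑ i, ∑ j, ‖E i j‖ ^ 2 := by
  simp only [Matrix.trace, Matrix.diag_apply, Matrix.mul_apply, Matrix.conjTranspose_apply,
    Complex.re_sum]
  refine Finset.sum_congr rfl fun i _ => Finset.sum_congr rfl fun j _ => ?_
  rw [← Complex.normSq_eq_norm_sq, Complex.star_def, Complex.mul_conj, Complex.ofReal_re]

theorem h2Integrand_eq_sum (g : ℂ → Matrix m n ℂ) (ω : ℝ) :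
    h2Integrand g ω = ∑ i, ∑ j, ‖g (Complex.I * ω) i j‖ ^ 2 := by
  rw [h2Integrand, Matrix.trace_mul_comm, trace_mul_conjTranspose_re]

/-- Cauchy–Schwarz applied to each entry of the product. -/
theorem sum_norm_sq_mul_le (E : Matrix l m ℂ) (F : Matrix m n ℂ) :
    ∑ i, ∑ j, ‖(E * F) i j‖ ^ 2 ≤ (∑ i, ∑ j, ‖E i j‖ ^ 2) * ∑ i, ∑ j, ‖F i j‖ ^ 2 := by
  rw [Finset.sum_mul, Finset.sum_comm (f := fun i j => ‖F i j‖ ^ 2)]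
  refine Finset.sum_le_sum fun i _ => ?_
  rw [Finset.mul_sum]
  refine Finset.sum_le_sum fun j _ => ?_
  calc ‖(E * F) i j‖ ^ 2 ≤ (∑ a, ‖E i a‖ * ‖F a j‖) ^ 2 := by
        rw [Matrix.mul_apply]
        gcongr
        exact (norm_sum_le _ _).trans_eq (Finset.sum_congr rfl fun a _ => norm_mul _ _)
    _ ≤ _ := Finset.sum_mul_sq_le_sq_mul_sq _ _ _

end Norms

/-! ### The integral of |jω - z|⁻² over the imaginary axis. -/

section Integral

theorem I_mul_sub_ne_zero {z : ℂ} (hz : z.re < 0) (ω : ℝ) : Complex.I * ω - z ≠ 0 := by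
  intro h
  have := congrArg Complex.re h
  simp at this
  linarith

/-- In this form, translation and scaling reduce the integral to that of 1 / (1 + x²). -/
theorem norm_inv_I_mul_sub_sq {z : ℂ} (hz : z.re < 0) (ω : ℝ) :
    ‖(Complex.I * ω - z)⁻¹‖ ^ 2 = (z.re ^ 2)⁻¹ * (1 + ((ω - z.im) / -z.re) ^ 2)⁻¹ := by
  have h : ‖Complex.I * ω - z‖ ^ 2 = z.re ^ 2 + (ω - z.im) ^ 2 := by
    rw [← Complex.normSq_eq_norm_sq, Complex.normSq_apply]
    simp
    ring
  have hz' : z.re ≠ 0 := hz.ne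
  rw [norm_inv, inv_pow, h, ← mul_inv]
  congr 1
  field_simp

theorem integrable_norm_inv_I_mul_sub_sq {z : ℂ} (hz : z.re < 0) :
    Integrable fun ω : ℝ => ‖(Complex.I * ω - z)⁻¹‖ ^ 2 := by
  simp_rw [norm_inv_I_mul_sub_sq hz]
  exact ((integrable_inv_one_add_sq.comp_div (neg_ne_zero.mpr hz.ne)).comp_sub_right
    z.im).const_mul _

theorem integral_norm_inv_I_mul_sub_sq {z : ℂ} (hz : z.re < 0) :
    ∫ ω : ℝ, ‖(Complex.I * ω - z)⁻¹‖ ^ 2 = Real.pi / -z.re := by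
  simp_rw [norm_inv_I_mul_sub_sq hz]
  rw [integral_const_mul,
    integral_sub_right_eq_self (fun x : ℝ => (1 + (x / -z.re) ^ 2)⁻¹) z.im,
    Measure.integral_comp_div (fun x : ℝ => (1 + x ^ 2)⁻¹), integral_univ_inv_one_add_sq,
    abs_of_pos (neg_pos.mpr hz), smul_eq_mul]
  have hz' : z.re ≠ 0 := hz.ne
  field_simp

end Integral

section Cauchy

variable {n k : ℕ} {Z₁ : Matrix (Fin n) (Fin n) ℂ} {B₁ : Matrix (Fin n) (Fin k) ℝ}
  {lam : Fin n → ℂ}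

/-- On the diagonal λ + λ̄ = 2 Re λ, and the numerator is the squared norm of a row of Z₁⁻¹ B₁. -/
theorem cauchyLike_diag (i : Fin n) :
    cauchyLike Z₁ B₁ lam i i =
      (((2 * -(lam i).re)⁻¹ * ∑ j, ‖(Z₁⁻¹ * toC B₁) i j‖ ^ 2 : ℝ) : ℂ) := by
  have h : (Z₁⁻¹ * toC B₁ * (toC B₁)ᵀ * (Z₁⁻¹)ᴴ) i i =
      ((∑ j, ‖(Z₁⁻¹ * toC B₁) i j‖ ^ 2 : ℝ) : ℂ) := by
    rw [← toC_conjTranspose, Matrix.mul_assoc _ (toC B₁)ᴴ, ← Matrix.conjTranspose_mul,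
      Matrix.mul_apply, Complex.ofReal_sum]
    refine Finset.sum_congr rfl fun j _ => ?_
    rw [Matrix.conjTranspose_apply, Complex.star_def, Complex.mul_conj,
      Complex.normSq_eq_norm_sq]
  rw [cauchyLike, Matrix.of_apply, h, Complex.star_def, Complex.add_conj]
  push_cast
  rw [one_div, mul_neg, inv_neg]

end Cauchy

/-! ### The H₂ bound for E (sI - Λ)⁻¹ F. -/

section HTwoBound

variable {n m : Type*} [Fintype n] [Fintype m] {ι : Type*} [Fintype ι] [DecidableEq ι]

/-- The sum of the squared entries of `(sI - Λ)⁻¹ F`. -/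
theorem sum_norm_sq_diagonal_inv_mul (lam : ι → ℂ) (F : Matrix ι m ℂ) (ω : ℝ) :
    ∑ i, ∑ j, ‖(diagonal (fun i => (Complex.I * ω - lam i)⁻¹) * F) i j‖ ^ 2 =
      ∑ i, ‖(Complex.I * ω - lam i)⁻¹‖ ^ 2 * ∑ j, ‖F i j‖ ^ 2 := by
  simp only [Matrix.diagonal_mul, norm_mul, mul_pow, Finset.mul_sum]

theorem integrable_h2Integrand_mul_diagonal_inv_mul {lam : ι → ℂ} (hlam : ∀ i, (lam i).re < 0)
    (E : Matrix n ι ℂ) (F : Matrix ι m ℂ) :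
    Integrable (h2Integrand fun s => E * (diagonal (fun i => (s - lam i)⁻¹) * F)) := by
  have hbound : Integrable fun ω : ℝ => (∑ i, ∑ j, ‖E i j‖ ^ 2) *
      ∑ i, ‖(Complex.I * ω - lam i)⁻¹‖ ^ 2 * ∑ j, ‖F i j‖ ^ 2 :=
    (integrable_finsetSum _ fun i _ =>
      (integrable_norm_inv_I_mul_sub_sq (hlam i)).mul_const _).const_mul _
  refine hbound.mono' ?_ (Filter.Eventually.of_forall fun ω => ?_)
  · refine Measurable.aestronglyMeasurable ?_
    simp only [funext (h2Integrand_eq_sum _), Matrix.mul_apply]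
    fun_prop
  · rw [h2Integrand_eq_sum, Real.norm_of_nonneg (by positivity),
      ← sum_norm_sq_diagonal_inv_mul]
    exact sum_norm_sq_mul_le _ _

theorem h2Norm_mul_diagonal_inv_mul_le {lam : ι → ℂ} (hlam : ∀ i, (lam i).re < 0)
    (E : Matrix n ι ℂ) (F : Matrix ι m ℂ) :
    h2Norm (fun s => E * (diagonal (fun i => (s - lam i)⁻¹) * F)) ≤
      √(∑ i, (2 * -(lam i).re)⁻¹ * ∑ j, ‖F i j‖ ^ 2) * frobNorm E := by
  have hint : ∀ i, Integrable fun ω : ℝ =>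
      ‖(Complex.I * ω - lam i)⁻¹‖ ^ 2 * ∑ j, ‖F i j‖ ^ 2 := fun i =>
    (integrable_norm_inv_I_mul_sub_sq (hlam i)).mul_const _
  have hle : ∫ ω : ℝ, h2Integrand (fun s => E * (diagonal (fun i => (s - lam i)⁻¹) * F)) ω ≤
      (∑ i, ∑ j, ‖E i j‖ ^ 2) * ∑ i, Real.pi / -(lam i).re * ∑ j, ‖F i j‖ ^ 2 := by
    calc _ ≤ ∫ ω : ℝ, (∑ i, ∑ j, ‖E i j‖ ^ 2) *
          ∑ i, ‖(Complex.I * ω - lam i)⁻¹‖ ^ 2 * ∑ j, ‖F i j‖ ^ 2 := by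
          refine integral_mono (integrable_h2Integrand_mul_diagonal_inv_mul hlam E F)
            ((integrable_finsetSum _ fun i _ => hint i).const_mul _) fun ω => ?_
          rw [h2Integrand_eq_sum, ← sum_norm_sq_diagonal_inv_mul]
          exact sum_norm_sq_mul_le _ _
      _ = _ := by
          rw [integral_const_mul, integral_finsetSum _ fun i _ => hint i]
          simp only [integral_mul_const, integral_norm_inv_I_mul_sub_sq (hlam _)]
  rw [h2Norm, frobNorm, trace_mul_conjTranspose_re, ← Real.sqrt_mul']
  · refine Real.sqrt_le_sqrt ?_
    refine (mul_le_mul_of_nonneg_left hle (by positivity)).trans_eq ?_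
    -- The normalization 1/(2π) cancels π and leaves the Cauchy weight 1 / (-2 Re λᵢ).
    have hsum : 1 / (2 * Real.pi) * ∑ i, Real.pi / -(lam i).re * ∑ j, ‖F i j‖ ^ 2 =
        ∑ i, (2 * -(lam i).re)⁻¹ * ∑ j, ‖F i j‖ ^ 2 := by
      rw [Finset.mul_sum]
      refine Finset.sum_congr rfl fun i _ => ?_
      have := (hlam i).ne
      field_simp
    rw [mul_left_comm, hsum, mul_comm]
  · positivity

end HTwoBound

end HamiltonianApprox

open HamiltonianApprox in
theorem theorem3 {n k p r nu q : ℕ}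
    (A : Matrix (Fin n) (Fin n) ℝ) (B₁ : Matrix (Fin n) (Fin k) ℝ)
    (B₂ : Matrix (Fin n) (Fin nu) ℝ) (C₁ : Matrix (Fin p) (Fin n) ℝ)
    (D₁₂ : Matrix (Fin q) (Fin nu) ℝ) (Pu : Matrix (Fin r) (Fin nu) ℝ)
    (M : Matrix (Fin n) (Fin n) ℝ) (hM : M = quadTerm B₂ Pu D₁₂)
    (hD : (D₁₂.transpose * D₁₂).PosDef) (hPu : LinearIndependent ℝ Pu.row)
    (X : Matrix (Fin n) (Fin n) ℝ) (hX : IsStabilizingSolution A M C₁ X)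
    (Z₁ Z₂ : Matrix (Fin n) (Fin n) ℂ) (lam : Fin n → ℂ)
    (hZ : IsStableEigenbasis (hamiltonian A M C₁) Z₁ Z₂ lam)
    (S : Finset (Fin n))
    (hS : IsUnit ((colsIn Z₂ S).conjTranspose * colsIn Z₁ S)) :
    IsUnit Z₁ ∧ toC X = Z₂ * Z₁⁻¹ ∧
    (∀ i, 0 ≤ (cauchyLike Z₁ B₁ lam i i).re ∧ (cauchyLike Z₁ B₁ lam i i).im = 0) ∧
    MeasureTheory.Integrable
      (h2Integrand fun s => (toC X - approxSolution Z₁ Z₂ S) * freqWeight A M X B₁ s) ∧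
    h2Norm (fun s => (toC X - approxSolution Z₁ Z₂ S) * freqWeight A M X B₁ s) ≤
      Real.sqrt (∑ i ∈ Sᶜ, (cauchyLike Z₁ B₁ lam i i).re) * frobNorm (errorFactor Z₁ Z₂ S) := by
  have hMt : M.transpose = M := hM ▸ quadTerm_transpose B₂ Pu D₁₂
  have hunit := hZ.isUnit hX
  have hXZ := hZ.eq_mul hMt hX
  have hdiag := cauchyLike_diag (Z₁ := Z₁) (B₁ := B₁) (lam := lam)
  have hlam : ∀ i : {i // i ∈ Sᶜ}, (lam i).re < 0 := fun i => hZ.stable i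
  let F : Matrix {i // i ∈ Sᶜ} (Fin k) ℂ := (Z₁⁻¹ * toC B₁).submatrix Subtype.val id
  let G : ℂ → Matrix (Fin n) (Fin k) ℂ := fun s => errorFactor Z₁ Z₂ S *
    (Matrix.diagonal (fun i : {i // i ∈ Sᶜ} => (s - lam i)⁻¹) * F)
  have hG : h2Integrand (fun s => (toC X - approxSolution Z₁ Z₂ S) * freqWeight A M X B₁ s) =
      h2Integrand G := by
    -- The factorization is needed only on the imaginary axis, where no λᵢ lies.
    ext ω
    have h : (toC X - approxSolution Z₁ Z₂ S) * freqWeight A M X B₁ (Complex.I * ω) =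
        G (Complex.I * ω) := by
      rw [hZ.freqWeight_eq hMt hX B₁ fun i => I_mul_sub_ne_zero (hZ.stable i) ω,
        sub_approxSolution_mul_mul hXZ hS]
      congr 1
      ext i j
      simp [F, Matrix.diagonal_mul]
    rw [h2Integrand, h, h2Integrand]
  refine ⟨hunit, ?_, fun i => ?_, ?_, ?_⟩
  · rw [← hXZ, Matrix.mul_nonsing_inv_cancel_right _ _
      ((Matrix.isUnit_iff_isUnit_det _).mp hunit)]
  · rw [hdiag, Complex.ofReal_re, Complex.ofReal_im]
    have := neg_pos.mpr (hZ.stable i)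
    exact ⟨by positivity, rfl⟩
  · rw [hG]
    exact integrable_h2Integrand_mul_diagonal_inv_mul hlam _ F
  · rw [h2Norm, hG]
    refine (h2Norm_mul_diagonal_inv_mul_le hlam (errorFactor Z₁ Z₂ S) F).trans_eq ?_
    simp only [hdiag, Complex.ofReal_re]
    rw [← Finset.sum_coe_sort Sᶜ]
    rfl
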